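/- Let $n\ge 1$, $\alpha\in(0,1)$, $\gamma>0$, let $\Omega\subset\mathbb R^n$ be a bounded open set (in particular, $\Omega$ may be any bounded domain with smooth boundary), and let $\varphi:\mathbb R^n\to[0,\infty)$ be a smooth function with compact support contained in $\Omega$. Put $$J(u)=\int_{\mathbb R^n}\int_{\mathbb R^n}\frac{|u(x)-u(y)|^2}{|x-y|^{n+2\alpha}}\,dx\,dy,\qquad H^\alpha(\mathbb R^n)=\{u\in L^2(\mathbb R^n): J(u)<\infty\}.$$ Let $\sigma,\delta,\varepsilon\in(0,1)$. Let $g_\sigma:\mathbb R\to\mathbb R$ be any smooth, non-negative, non-increasing, convex function with $g_\sigma(t)=-\frac1\sigma\left(t+\frac\sigma2\right)$ for $t\le-\sigma$ and $g_\sigma(t)=0$ for $t\ge0$. Let $h_\delta:\mathbb R\to\mathbb R$ be the continuous function that vanishes on $(-\infty,0]$, is linear on $[0,\delta]$, and equals $1$ on $[\delta,\infty)$. Let $f_\varepsilon(t)=\frac1\varepsilon(t-\gamma)$ for $t\ge\gamma$, $f_\varepsilon(t)=\varepsilon(t-\gamma)$ for $t\le\gamma$, and $f_\varepsilon(+\infty)=+\infty$.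 For $u\in H^\alpha(\mathbb R^n)$ set $$I_{\sigma,\delta,\varepsilon}(u)=J(u)+\int_{\mathbb R^n}g_\sigma(u-\varphi)\,dx+f_\varepsilon\left(\int_{\mathbb R^n\setminus\Omega}h_\delta(u)\,dx\right)\in(-\infty,+\infty].$$ Then $I_{\sigma,\delta,\varepsilon}$ has a minimizer over $H^\alpha(\mathbb R^n)$, at which its value is finite. Moreover, every minimizer $u$ of $I_{\sigma,\delta,\varepsilon}$ over $H^\alpha(\mathbb R^n)$ satisfies $0\le u\le\|\varphi\|_\infty$ almost everywhere in $\mathbb R^n$, where $\|\varphi\|_\infty=\sup_{\mathbb R^n}|\varphi|$. -/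

import Mathlib

open MeasureTheory Set
open scoped ENNReal ContDiff

noncomputable section

namespace FracPenalization

/-- The fractional energy
`J(u) = ∫∫ |u(x) - u(y)|² / |x - y|^(n + 2α) dx dy`, with values in `[0, ∞]`. -/
def energy {n : ℕ} (α : ℝ) (u : EuclideanSpace ℝ (Fin n) → ℝ) : ℝ≥0∞ :=
  ∫⁻ x, ∫⁻ y, ENNReal.ofReal (|u x - u y| ^ 2 / ‖x - y‖ ^ ((n : ℝ) + 2 * α))

/-- The fractional Sobolev space `H^α(ℝⁿ)`: the square integrable functions with finite
energy `J`. Its elements are represented by functions; everything below depends only on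
their almost-everywhere class. -/
def fracSobolev (n : ℕ) (α : ℝ) : Set (EuclideanSpace ℝ (Fin n) → ℝ) :=
  {u | MemLp u 2 volume ∧ energy α u < ⊤}

/-- The properties prescribed for the obstacle penalty `g_σ`. -/
structure IsObstaclePenalty (σ : ℝ) (g : ℝ → ℝ) : Prop where
  smooth : ContDiff ℝ ∞ g
  nonneg : ∀ t, 0 ≤ g t
  antitone : Antitone g
  convex : ConvexOn ℝ univ g
  eq_of_le : ∀ t, t ≤ -σ → g t = -(1 / σ) * (t + σ / 2)
  eq_zero_of_nonneg : ∀ t, 0 ≤ t → g t = 0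

/-- The regularized step `h_δ`: zero on `(-∞, 0]`, linear on `[0, δ]`, one on `[δ, ∞)`. -/
def stepReg (δ t : ℝ) : ℝ :=
  if t ≤ 0 then 0 else if t ≤ δ then t / δ else 1

/-- The volume penalty `f_ε` on the real line. -/
def volPenalty (γ ε t : ℝ) : ℝ :=
  if γ ≤ t then (1 / ε) * (t - γ) else ε * (t - γ)

/-- The volume penalty on `[0, ∞]`, extended by its limit `f_ε(∞) = ∞`. -/
def volPenaltyExt (γ ε : ℝ) (t : ℝ≥0∞) : EReal :=
  if t = ⊤ then ⊤ else (volPenalty γ ε t.toReal : EReal)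

/-- The penalized functional
`I(u) = J(u) + ∫ g(u - φ) dx + f_ε (∫_{Ωᶜ} h_δ(u) dx)`, with values in `(-∞, ∞]`.
The integrals are those of nonnegative functions, so a divergent one has the value `∞`. -/
def penalized {n : ℕ} (α γ δ ε : ℝ) (g : ℝ → ℝ) (Ω : Set (EuclideanSpace ℝ (Fin n)))
    (φ u : EuclideanSpace ℝ (Fin n) → ℝ) : EReal :=
  (energy α u : EReal)
    + ((∫⁻ x, ENNReal.ofReal (g (u x - φ x)) : ℝ≥0∞) : EReal)
    + volPenaltyExt γ ε (∫⁻ x in Ωᶜ, ENNReal.ofReal (stepReg δ (u x)))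

/-- `u` is a minimizer of the penalized functional over `H^α(ℝⁿ)`. -/
def IsMinimizer {n : ℕ} (α γ δ ε : ℝ) (g : ℝ → ℝ) (Ω : Set (EuclideanSpace ℝ (Fin n)))
    (φ u : EuclideanSpace ℝ (Fin n) → ℝ) : Prop :=
  u ∈ fracSobolev n α ∧
    ∀ v ∈ fracSobolev n α, penalized α γ δ ε g Ω φ u ≤ penalized α γ δ ε g Ω φ v

end FracPenalization

end

/-!
The proof is the direct method combined with a truncation argument. With `M = sup |φ|`, replacing
`u` by its truncation to `[0, M]` increases none of the three terms of the functional
(`terms_clamp_le`), so a minimizing sequence may be taken with values in `[0, M]`. Along a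
subsequence the three terms converge in the compact space `[0, ∞]³`, and the functional is a
continuous monotone function of them (`continuous_combine`, `combine_mono`); Fatou's lemma therefore
finishes the proof of existence once a subsequence converges almost everywhere
(`terms_le_of_tendsto`, `exists_isMinimizer`). The limit is square integrable because `Ω` has
finite measure and the volume term controls a function with values in `[0, M]` outside `Ω`.

Almost everywhere convergence of a subsequence, `exists_subseq_ae_tendsto_of_energy_le`, is a local
Rellich theorem. By Jensen's inequality the energy bounds the `L²` distance from `u` to its averages
over the grid of cubes of side `1 / N` by a constant that tends to `0` with `1 / N`
(`lintegral_sq_sub_cubeMean_le`). The countably many cube means of a sequence with values in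
`[0, M]` converge along a diagonal subsequence, which is consequently Cauchy in `L²` of any finite
measure dominated by Lebesgue measure.

For the bounds on a minimizer `u`, minimality forces the truncation of `u` to have the same finite
energy as `u`. Truncation strictly decreases `|u(x) - u(y)|` as soon as `u(x) ∉ [0, M]` and
`u(y) ≠ u(x)`, so if `u` left `[0, M]` on a set of positive measure, it would be almost everywhere
equal to a nonzero constant, which is not square integrable
(`ae_mem_Icc_of_energy_le_energy_clamp`).
-/

namespace FracPenalization

open Filter Topology

/-! ### Truncation -/

/-- The truncation of a real number to the interval `[0, M]`. -/
noncomputable def clamp (M t : ℝ) : ℝ := max 0 (min t M)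

lemma clamp_nonneg (M t : ℝ) : 0 ≤ clamp M t := le_max_left _ _

lemma clamp_le {M : ℝ} (hM : 0 ≤ M) (t : ℝ) : clamp M t ≤ M :=
  max_le hM (min_le_right _ _)

lemma continuous_clamp (M : ℝ) : Continuous (clamp M) := by
  unfold clamp; fun_prop

lemma abs_clamp_sub_clamp_le (M s t : ℝ) : |clamp M s - clamp M t| ≤ |s - t| := by
  unfold clamp
  refine (abs_max_sub_max_le_max _ _ _ _).trans ?_
  simp only [sub_self, abs_zero]
  refine max_le (abs_nonneg _) ((abs_min_sub_min_le_max _ _ _ _).trans ?_)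
  simp

lemma clamp_zero {M : ℝ} (hM : 0 ≤ M) : clamp M 0 = 0 := by
  simp [clamp, hM]

lemma abs_clamp_le {M : ℝ} (hM : 0 ≤ M) (t : ℝ) : |clamp M t| ≤ |t| := by
  simpa [clamp_zero hM] using abs_clamp_sub_clamp_le M t 0

/-- Truncation strictly shortens every nontrivial segment with an endpoint outside `[0, M]`. -/
lemma eq_of_abs_clamp_sub_clamp_eq {M s t : ℝ} (hM : 0 ≤ M) (ht : t ∉ Icc 0 M)
    (h : |clamp M t - clamp M s| = |t - s|) : s = t := by
  rw [mem_Icc, not_and_or, not_le, not_le] at ht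
  unfold clamp at h
  rcases ht with ht | ht <;> rcases le_total s 0 with h0 | h0 <;>
    rcases le_total s M with h1 | h1 <;> rcases abs_cases (t - s) with h2 | h2 <;>
    rcases abs_cases (max 0 (min t M) - max 0 (min s M)) with h3 | h3 <;>
    grind

/-! ### The energy -/

variable {n : ℕ}

/-- The integrand of the fractional energy. -/
noncomputable def energyDensity (α : ℝ) (u : EuclideanSpace ℝ (Fin n) → ℝ)
    (x y : EuclideanSpace ℝ (Fin n)) : ℝ≥0∞ :=
  ENNReal.ofReal (|u x - u y| ^ 2 / ‖x - y‖ ^ ((n : ℝ) + 2 * α))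

lemma energy_eq (α : ℝ) (u : EuclideanSpace ℝ (Fin n) → ℝ) :
    energy α u = ∫⁻ x, ∫⁻ y, energyDensity α u x y := rfl

lemma energy_congr {α : ℝ} {u v : EuclideanSpace ℝ (Fin n) → ℝ} (h : u =ᵐ[volume] v) :
    energy α u = energy α v := by
  refine lintegral_congr_ae ?_
  filter_upwards [h] with x hx
  refine lintegral_congr_ae ?_
  filter_upwards [h] with y hy
  rw [hx, hy]

lemma measurable_energyDensity {α : ℝ} {u : EuclideanSpace ℝ (Fin n) → ℝ} (hu : Measurable u) :
    Measurable (Function.uncurry (energyDensity α u)) := by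
  unfold energyDensity Function.uncurry
  fun_prop

lemma aemeasurable_energyDensity {α : ℝ} {u : EuclideanSpace ℝ (Fin n) → ℝ}
    (hu : AEMeasurable u volume) (x : EuclideanSpace ℝ (Fin n)) :
    AEMeasurable (energyDensity α u x) volume := by
  unfold energyDensity
  fun_prop

lemma aemeasurable_lintegral_energyDensity {α : ℝ} {u : EuclideanSpace ℝ (Fin n) → ℝ}
    (hu : AEMeasurable u volume) :
    AEMeasurable (fun x => ∫⁻ y, energyDensity α u x y) volume := by
  refine ⟨fun x => ∫⁻ y, energyDensity α (hu.mk u) x y,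
    (measurable_energyDensity hu.measurable_mk).lintegral_prod_right', ?_⟩
  filter_upwards [hu.ae_eq_mk] with x hx
  refine lintegral_congr_ae ?_
  filter_upwards [hu.ae_eq_mk] with y hy
  rw [energyDensity, hx, hy, energyDensity]

lemma energyDensity_clamp_le (α M : ℝ) (u : EuclideanSpace ℝ (Fin n) → ℝ)
    (x y : EuclideanSpace ℝ (Fin n)) :
    energyDensity α (fun z => clamp M (u z)) x y ≤ energyDensity α u x y := by
  unfold energyDensity
  refine ENNReal.ofReal_le_ofReal (div_le_div_of_nonneg_right ?_ (by positivity))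
  exact pow_le_pow_left₀ (abs_nonneg _) (abs_clamp_sub_clamp_le _ _ _) 2

lemma energy_clamp_le (α M : ℝ) (u : EuclideanSpace ℝ (Fin n) → ℝ) :
    energy α (fun z => clamp M (u z)) ≤ energy α u :=
  lintegral_mono fun _ => lintegral_mono fun _ => energyDensity_clamp_le _ _ _ _ _

lemma clamp_mem_fracSobolev {α M : ℝ} (hM : 0 ≤ M) {u : EuclideanSpace ℝ (Fin n) → ℝ}
    (hu : u ∈ fracSobolev n α) : (fun x => clamp M (u x)) ∈ fracSobolev n α :=
  ⟨hu.1.mono ((continuous_clamp M).comp_aestronglyMeasurable hu.1.1)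
    (Eventually.of_forall fun x => by simpa using abs_clamp_le hM (u x)),
    (energy_clamp_le α M u).trans_lt hu.2⟩

/-- Equality of energies forces `u(x) - u(y)` and its truncated version to have the same size for
almost all `x`, `y`, so a single generic value of `u` outside `[0, M]` makes `u` constant. On a
space of infinite measure, a square integrable constant vanishes. -/
lemma ae_mem_Icc_of_energy_le_energy_clamp (hn : 1 ≤ n) {α M : ℝ} (hM : 0 ≤ M)
    {u : EuclideanSpace ℝ (Fin n) → ℝ} (hu : u ∈ fracSobolev n α)
    (h : energy α u ≤ energy α (fun z => clamp M (u z))) :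
    ∀ᵐ x ∂volume, u x ∈ Icc 0 M := by
  have hum : AEMeasurable u volume := hu.1.1.aemeasurable
  have hlt := (energy_clamp_le α M u).trans_lt hu.2
  have houter := ae_eq_of_ae_le_of_lintegral_le
    (Eventually.of_forall fun x => lintegral_mono (energyDensity_clamp_le α M u x)) hlt.ne
    (aemeasurable_lintegral_energyDensity hum) h
  have hfin := ae_lt_top' (aemeasurable_lintegral_energyDensity hum) hu.2.ne
  have key : ∀ᵐ x ∂volume, u x ∉ Icc 0 M → ∀ᵐ y ∂volume, u y = u x := by
    filter_upwards [houter, hfin] with x hx hxfin hxM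
    have hinner := ae_eq_of_ae_le_of_lintegral_le
      (Eventually.of_forall (energyDensity_clamp_le α M u x)) (hx.trans_lt hxfin).ne
      (aemeasurable_energyDensity hum x) hx.ge
    filter_upwards [hinner] with y hy
    by_cases hxy : x = y
    · rw [hxy]
    have hpos : 0 < ‖x - y‖ ^ ((n : ℝ) + 2 * α) :=
      Real.rpow_pos_of_pos (norm_pos_iff.2 (sub_ne_zero.2 hxy)) _
    unfold energyDensity at hy
    rw [ENNReal.ofReal_eq_ofReal_iff (by positivity) (by positivity),
      div_left_inj' hpos.ne', sq_eq_sq₀ (abs_nonneg _) (abs_nonneg _)] at hy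
    exact eq_of_abs_clamp_sub_clamp_eq hM hxM hy
  by_contra hcon
  obtain ⟨x, hxM, hx⟩ := (Frequently.and_eventually (not_eventually.1 hcon) key).exists
  have hconst : u =ᵐ[volume] fun _ => u x := hx hxM
  have hL2 : MemLp (fun _ : EuclideanSpace ℝ (Fin n) => u x) 2 volume := hu.1.ae_eq hconst
  rw [memLp_const_iff (by norm_num) (by norm_num)] at hL2
  have : Nonempty (Fin n) := ⟨⟨0, hn⟩⟩
  have : NoncompactSpace (EuclideanSpace ℝ (Fin n)) :=
    NormedSpace.noncompactSpace ℝ (EuclideanSpace ℝ (Fin n))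
  rcases hL2 with h0 | h0
  · exact hxM (by rw [h0]; exact ⟨le_rfl, hM⟩)
  · simp at h0

/-- Lower semicontinuity of the energy under almost everywhere convergence. -/
lemma energy_le_liminf {α : ℝ} {u : EuclideanSpace ℝ (Fin n) → ℝ}
    {v : ℕ → EuclideanSpace ℝ (Fin n) → ℝ} (hv : ∀ k, AEMeasurable (v k) volume)
    (h : ∀ᵐ x ∂volume, Tendsto (fun k => v k x) atTop (𝓝 (u x))) :
    energy α u ≤ liminf (fun k => energy α (v k)) atTop := by
  refine le_trans ?_ (lintegral_liminf_le' fun k => aemeasurable_lintegral_energyDensity (hv k))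
  refine lintegral_mono_ae ?_
  filter_upwards [h] with x hx
  refine le_trans ?_ (lintegral_liminf_le' fun k => aemeasurable_energyDensity (hv k) x)
  refine lintegral_mono_ae ?_
  filter_upwards [h] with y hy
  refine (Tendsto.liminf_eq ?_).ge
  exact (ENNReal.continuous_ofReal.tendsto _).comp (((hx.sub hy).abs.pow 2).div_const _)

/-! ### Averaging over a grid of cubes -/

/-- The index of the cell containing `x` in the grid of half-open cubes of side `1 / N`. -/
noncomputable def cubeIndex (N : ℕ) (x : EuclideanSpace ℝ (Fin n)) : Fin n → ℤ :=
  fun i => ⌊(N : ℝ) * x i⌋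

/-- The half-open cube of side `1 / N` with lower corner `z / N`. -/
def cube (N : ℕ) (z : Fin n → ℤ) : Set (EuclideanSpace ℝ (Fin n)) :=
  cubeIndex N ⁻¹' {z}

/-- The mean value of `u` over a grid cube. -/
noncomputable def cubeMean (N : ℕ) (u : EuclideanSpace ℝ (Fin n) → ℝ) (z : Fin n → ℤ) : ℝ :=
  ⨍ y in cube N z, u y

lemma measurable_cubeIndex (N : ℕ) :
    Measurable (cubeIndex N : EuclideanSpace ℝ (Fin n) → Fin n → ℤ) := by
  unfold cubeIndex
  refine measurable_pi_lambda _ fun i => Int.measurable_floor.comp ?_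
  fun_prop

lemma measurableSet_cube (N : ℕ) (z : Fin n → ℤ) : MeasurableSet (cube N z) :=
  measurable_cubeIndex N (measurableSet_singleton z)

lemma cube_eq_preimage_pi {N : ℕ} (hN : 0 < N) (z : Fin n → ℤ) :
    cube N z = (MeasurableEquiv.toLp 2 (Fin n → ℝ)).symm ⁻¹'
      (univ.pi fun i => Ico ((z i : ℝ) / N) ((z i + 1 : ℝ) / N)) := by
  have hN' : (0 : ℝ) < N := by exact_mod_cast hN
  ext x
  simp only [cube, cubeIndex, mem_preimage, mem_singleton_iff, mem_univ_pi, mem_Ico, funext_iff,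
    Int.floor_eq_iff, MeasurableEquiv.coe_toLp_symm, div_le_iff₀' hN', lt_div_iff₀' hN']

lemma volume_cube {N : ℕ} (hN : 0 < N) (z : Fin n → ℤ) :
    volume (cube N z) = ENNReal.ofReal (((N : ℝ) ^ n)⁻¹) := by
  have hN' : (0 : ℝ) < N := by exact_mod_cast hN
  rw [cube_eq_preimage_pi hN,
    (EuclideanSpace.volume_preserving_symm_measurableEquiv_toLp (Fin n)).measure_preimage_equiv,
    Real.volume_pi_Ico]
  have : ∀ i, ((z i + 1 : ℝ) / N - (z i : ℝ) / N) = (N : ℝ)⁻¹ := fun i => by field_simp; ring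
  simp only [this, Finset.prod_const, Finset.card_univ, Fintype.card_fin]
  rw [← ENNReal.ofReal_pow (by positivity), inv_pow]

lemma norm_sub_le_of_mem_cube {N : ℕ} (hN : 0 < N) {x y : EuclideanSpace ℝ (Fin n)}
    (h : y ∈ cube N (cubeIndex N x)) : ‖x - y‖ ≤ √n / N := by
  have hN' : (0 : ℝ) < N := by exact_mod_cast hN
  have hi : ∀ i, ‖(x - y) i‖ ^ 2 ≤ ((N : ℝ)⁻¹) ^ 2 := by
    intro i
    have h1 : ⌊(N : ℝ) * y i⌋ = ⌊(N : ℝ) * x i⌋ := congrFun h i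
    have h2 := Int.abs_sub_lt_one_of_floor_eq_floor h1
    rw [← mul_sub, abs_mul, abs_of_pos hN'] at h2
    refine pow_le_pow_left₀ (norm_nonneg _) ?_ 2
    rw [PiLp.sub_apply, Real.norm_eq_abs, abs_sub_comm, ← one_div, le_div_iff₀' hN']
    exact h2.le
  rw [EuclideanSpace.norm_eq, div_eq_mul_inv]
  refine (Real.sqrt_le_sqrt (Finset.sum_le_sum fun i _ => hi i)).trans ?_
  rw [Finset.sum_const, Finset.card_univ, Fintype.card_fin, nsmul_eq_mul,
    Real.sqrt_mul (by positivity), Real.sqrt_sq (by positivity)]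

/-- The constant in the estimate of `u` minus its grid average: the reciprocal volume of a cube of
side `1 / N` times the power `n + 2α` of its diameter. -/
noncomputable def cubeConst (n : ℕ) (α : ℝ) (N : ℕ) : ℝ :=
  (N : ℝ) ^ n * (√n / N) ^ ((n : ℝ) + 2 * α)

lemma tendsto_cubeConst (n : ℕ) {α : ℝ} (hα : 0 < α) :
    Tendsto (cubeConst n α) atTop (𝓝 0) := by
  have h : Tendsto (fun N : ℕ => √n ^ ((n : ℝ) + 2 * α) * (N : ℝ) ^ (-(2 * α))) atTop (𝓝 0) := by
    simpa using ((tendsto_rpow_neg_atTop (by positivity : 0 < 2 * α)).comp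
      tendsto_natCast_atTop_atTop).const_mul (√n ^ ((n : ℝ) + 2 * α))
  refine h.congr' ?_
  filter_upwards [eventually_gt_atTop 0] with N hN
  have hN' : (0 : ℝ) < N := by exact_mod_cast hN
  rw [cubeConst, Real.div_rpow (by positivity) (by positivity), Real.rpow_add hN',
    Real.rpow_neg hN'.le, Real.rpow_natCast]
  field_simp

lemma integrableOn_cube {N : ℕ} (hN : 0 < N) {M : ℝ}
    {u : EuclideanSpace ℝ (Fin n) → ℝ} (hu : Measurable u) (hb : ∀ x, |u x| ≤ M)
    (z : Fin n → ℤ) : IntegrableOn u (cube N z) volume :=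
  Measure.integrableOn_of_bounded (M := M) (by rw [volume_cube hN]; exact ENNReal.ofReal_ne_top)
    hu.aestronglyMeasurable (Eventually.of_forall hb)

lemma cubeMean_mem_Icc {N : ℕ} (hN : 0 < N) {M : ℝ} {u : EuclideanSpace ℝ (Fin n) → ℝ}
    (hu : Measurable u) (hb : ∀ x, u x ∈ Icc 0 M) (z : Fin n → ℤ) :
    cubeMean N u z ∈ Icc 0 M := by
  have hN' : (0 : ℝ) < N := by exact_mod_cast hN
  refine (convex_Icc 0 M).set_average_mem isClosed_Icc ?_ ?_ (Eventually.of_forall hb)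
    (integrableOn_cube hN hu
      (fun x => abs_le.2 ⟨by linarith [(hb x).1, (hb x).2], (hb x).2⟩) z)
  · rw [volume_cube hN]; simpa using pow_pos hN' n
  · rw [volume_cube hN]; exact ENNReal.ofReal_ne_top

/-- The energy controls the distance from `u` to its grid average: by Jensen's inequality
`|u(x) - ⨍_Q u|²` is at most the mean of `|u(x) - u(y)|²` over the cube `Q` containing `x`, where
`|x - y|` is at most the diameter of `Q`. -/
lemma sq_sub_cubeMean_le {N : ℕ} (hN : 0 < N) {α : ℝ} (hα : 0 < α) {M : ℝ}
    {u : EuclideanSpace ℝ (Fin n) → ℝ} (hu : Measurable u) (hb : ∀ x, u x ∈ Icc 0 M)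
    (x : EuclideanSpace ℝ (Fin n)) :
    ENNReal.ofReal (|u x - cubeMean N u (cubeIndex N x)| ^ 2) ≤
      ENNReal.ofReal (cubeConst n α N) * ∫⁻ y, energyDensity α u x y := by
  have hN' : (0 : ℝ) < N := by exact_mod_cast hN
  set Q := cube N (cubeIndex N x)
  have hvol : volume Q = ENNReal.ofReal (((N : ℝ) ^ n)⁻¹) := volume_cube hN _
  have hvreal : volume.real Q = ((N : ℝ) ^ n)⁻¹ := by
    rw [measureReal_def, hvol, ENNReal.toReal_ofReal (by positivity)]
  have h0 : volume Q ≠ 0 := by rw [hvol]; simpa using pow_pos hN' n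
  have hT : volume Q ≠ ⊤ := by rw [hvol]; exact ENNReal.ofReal_ne_top
  have hdb : ∀ y, |u x - u y| ≤ M := fun y =>
    abs_le.2 ⟨by linarith [(hb x).1, (hb y).2], by linarith [(hb x).2, (hb y).1]⟩
  have hdm : Measurable fun y => u x - u y := measurable_const.sub hu
  have hint := integrableOn_cube hN hdm hdb (cubeIndex N x)
  have hint2 : IntegrableOn (fun y => (u x - u y) ^ 2) Q volume :=
    integrableOn_cube (M := M ^ 2) hN (hdm.pow_const 2)
      (fun y => by rw [abs_pow]; exact pow_le_pow_left₀ (abs_nonneg _) (hdb y) 2) _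
  have hmean : u x - cubeMean N u (cubeIndex N x) = ⨍ y in Q, (u x - u y) := by
    have hintu := integrableOn_cube hN hu
      (fun x => abs_le.2 ⟨by linarith [(hb x).1, (hb x).2], (hb x).2⟩) (cubeIndex N x)
    have hconst : IntegrableOn (fun _ => u x) Q volume := integrableOn_const hT
    rw [setAverage_eq, integral_sub hconst hintu, cubeMean, setAverage_eq, smul_sub,
      setIntegral_const, smul_smul, inv_mul_cancel₀, one_smul]
    rw [hvreal]; positivity
  have hjensen : (⨍ y in Q, (u x - u y)) ^ 2 ≤ ⨍ y in Q, (u x - u y) ^ 2 :=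
    (even_two.convexOn_pow (𝕜 := ℝ)).map_set_average_le (by fun_prop) isClosed_univ h0 hT
      (Eventually.of_forall fun _ => mem_univ _) hint hint2
  rw [sq_abs, hmean]
  refine (ENNReal.ofReal_le_ofReal hjensen).trans ?_
  rw [setAverage_eq, hvreal, inv_inv, smul_eq_mul, ENNReal.ofReal_mul (by positivity),
    ofReal_integral_eq_lintegral_ofReal hint2 (Eventually.of_forall fun _ => sq_nonneg _),
    cubeConst, ENNReal.ofReal_mul (by positivity), mul_assoc]
  gcongr
  rw [← lintegral_const_mul' _ _ ENNReal.ofReal_ne_top]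
  refine le_trans (setLIntegral_mono' (measurableSet_cube N _) fun y hy => ?_)
    (setLIntegral_le_lintegral Q _)
  have hd := norm_sub_le_of_mem_cube hN hy
  rw [energyDensity, ← ENNReal.ofReal_mul (by positivity), sq_abs]
  refine ENNReal.ofReal_le_ofReal ?_
  by_cases hxy : x = y
  · simp [hxy]
  have hpos : 0 < ‖x - y‖ := norm_pos_iff.2 (sub_ne_zero.2 hxy)
  rw [mul_div_assoc', le_div_iff₀ (by positivity), mul_comm]
  gcongr

/-- The square of the `L²` distance from `u` to its grid average is at most
`cubeConst n α N * J(u)`. -/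
lemma lintegral_sq_sub_cubeMean_le {N : ℕ} (hN : 0 < N) {α : ℝ} (hα : 0 < α) {M : ℝ}
    {u : EuclideanSpace ℝ (Fin n) → ℝ} (hu : Measurable u) (hb : ∀ x, u x ∈ Icc 0 M) :
    ∫⁻ x, ENNReal.ofReal (|u x - cubeMean N u (cubeIndex N x)| ^ 2) ≤
      ENNReal.ofReal (cubeConst n α N) * energy α u := by
  rw [energy_eq, ← lintegral_const_mul' _ _ ENNReal.ofReal_ne_top]
  exact lintegral_mono (sq_sub_cubeMean_le hN hα hu hb)

/-! ### Compactness -/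

/-- A σ-finite measure dominates a finite measure with the same null sets. -/
lemma exists_isFiniteMeasure_le_absolutelyContinuous {X : Type*} [MeasurableSpace X]
    (μ : Measure X) [SigmaFinite μ] :
    ∃ ν : Measure X, IsFiniteMeasure ν ∧ ν ≤ μ ∧ μ ≪ ν := by
  obtain ⟨w, hw0, hwm, hw⟩ := exists_pos_lintegral_lt_of_sigmaFinite μ one_ne_zero
  have hm : Measurable fun x => min (w x : ℝ≥0∞) 1 := hwm.coe_nnreal_ennreal.min measurable_const
  refine ⟨μ.withDensity fun x => min (w x : ℝ≥0∞) 1, isFiniteMeasure_withDensity ?_, ?_,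
    withDensity_absolutelyContinuous' hm.aemeasurable (Eventually.of_forall fun x => ?_)⟩
  · exact ((lintegral_mono fun x => min_le_left _ _).trans_lt (hw.trans ENNReal.one_lt_top)).ne
  · calc μ.withDensity (fun x => min (w x : ℝ≥0∞) 1) ≤ μ.withDensity 1 :=
        withDensity_mono (Eventually.of_forall fun x => min_le_right _ _)
      _ = μ := withDensity_one
  · simpa using (hw0 x).ne'

/-- For a finite measure, a sequence that can be approximated in `L²`, uniformly and to any
precision, by uniformly bounded pointwise convergent sequences is Cauchy in `L²`, hence has an
almost everywhere convergent subsequence. -/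
lemma exists_subseq_ae_tendsto_of_approx {X : Type*} [MeasurableSpace X] {ν : Measure X}
    [IsFiniteMeasure ν] {M : ℝ} {f : ℕ → X → ℝ} (hf : ∀ k, MemLp (f k) 2 ν)
    (h : ∀ η : ℝ≥0∞, 0 < η → ∃ (F : ℕ → X → ℝ) (G : X → ℝ), (∀ k, Measurable (F k)) ∧
      (∀ k x, |F k x| ≤ M) ∧ (∀ x, Tendsto (fun k => F k x) atTop (𝓝 (G x))) ∧
      ∀ k, eLpNorm (f k - F k) 2 ν ≤ η) :
    ∃ (ψ : ℕ → ℕ) (g : X → ℝ), StrictMono ψ ∧ AEStronglyMeasurable g ν ∧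
      ∀ᵐ x ∂ν, Tendsto (fun k => f (ψ k) x) atTop (𝓝 (g x)) := by
  have hcauchy : CauchySeq fun k => (hf k).toLp (f k) := by
    rw [EMetric.cauchySeq_iff]
    intro η hη
    have hη4 : 0 < η / 5 := ENNReal.div_pos hη.ne' (by norm_num)
    obtain ⟨F, G, hFm, hFb, hFG, happrox⟩ := h (η / 5) hη4
    have hGb : ∀ x, |G x| ≤ M := fun x =>
      le_of_tendsto (hFG x).abs (Eventually.of_forall fun k => hFb k x)
    have hGm : Measurable G := measurable_of_tendsto_metrizable hFm (tendsto_pi_nhds.2 hFG)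
    have hui : UnifIntegrable F 2 ν := by
      refine unifIntegrable_of one_le_two (by norm_num) (fun k => (hFm k).aestronglyMeasurable)
        fun _ _ => ⟨(M + 1).toNNReal, fun k => ?_⟩
      have hempty : {x | (M + 1).toNNReal ≤ ‖F k x‖₊} = ∅ := by
        refine eq_empty_of_forall_notMem fun x hx => ?_
        have hx' := Real.toNNReal_le_iff_le_coe.1 hx
        rw [coe_nnnorm, Real.norm_eq_abs] at hx'
        linarith [hFb k x]
      rw [hempty]
      simp
    have hlim := tendsto_Lp_finite_of_tendsto_ae one_le_two (by norm_num)
      (fun k => (hFm k).aestronglyMeasurable)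
      (MemLp.of_bound hGm.aestronglyMeasurable M (Eventually.of_forall hGb)) hui
      (Eventually.of_forall hFG)
    obtain ⟨K, hK⟩ := ENNReal.tendsto_atTop_zero.1 hlim (η / 5) hη4
    have hstep : ∀ k ≥ K, eLpNorm (f k - G) 2 ν ≤ η / 5 + η / 5 := by
      intro k hk
      calc eLpNorm (f k - G) 2 ν = eLpNorm ((f k - F k) + (F k - G)) 2 ν := by
            rw [sub_add_sub_cancel]
        _ ≤ _ := eLpNorm_add_le ((hf k).1.sub (hFm k).aestronglyMeasurable)
            ((hFm k).aestronglyMeasurable.sub hGm.aestronglyMeasurable) one_le_two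
        _ ≤ _ := add_le_add (happrox k) (hK k hk)
    refine ⟨K, fun m hm l hl => ?_⟩
    by_cases hηt : η = ⊤
    · rw [hηt]
      exact edist_lt_top _ _
    rw [Lp.edist_toLp_toLp]
    calc eLpNorm (f m - f l) 2 ν = eLpNorm ((f m - G) - (f l - G)) 2 ν := by
          rw [sub_sub_sub_cancel_right]
      _ ≤ _ := eLpNorm_sub_le ((hf m).1.sub hGm.aestronglyMeasurable)
          ((hf l).1.sub hGm.aestronglyMeasurable) one_le_two
      _ ≤ (η / 5 + η / 5) + (η / 5 + η / 5) := add_le_add (hstep m hm) (hstep l hl)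
      _ < η := by
        lift η to NNReal using hηt
        have hη' : 0 < η := by exact_mod_cast hη
        have : ((η : ℝ≥0∞) / 5) = ((η / 5 : NNReal) : ℝ≥0∞) := by
          rw [ENNReal.coe_div (by norm_num)]; norm_num
        rw [this]
        norm_cast
        rw [← NNReal.coe_lt_coe] at hη' ⊢
        push_cast at hη' ⊢
        linarith
  obtain ⟨g, hg⟩ := cauchySeq_tendsto_of_complete hcauchy
  obtain ⟨ψ, hψ, hae⟩ := (tendstoInMeasure_of_tendsto_Lp hg).exists_seq_tendsto_ae
  refine ⟨ψ, g, hψ, (Lp.memLp g).1, ?_⟩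
  filter_upwards [hae, ae_all_iff.2 fun k => (hf k).coeFn_toLp] with x hx hfx
  simpa [hfx] using hx

/-- Sequences with values in `[0, M]` and bounded energy have almost everywhere convergent
subsequences. A diagonal subsequence makes the means over all cubes of all grids converge, so
every grid average converges pointwise, and the grid averages approximate the sequence in `L²`
uniformly as the grid is refined. -/
lemma exists_subseq_ae_tendsto_of_energy_le {n : ℕ} {α : ℝ} (hα : 0 < α) {M : ℝ}
    {C : ℝ≥0∞} (hC : C ≠ ⊤) {u : ℕ → EuclideanSpace ℝ (Fin n) → ℝ} (hu : ∀ k, Measurable (u k))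
    (hb : ∀ k x, u k x ∈ Icc 0 M) (hE : ∀ k, energy α (u k) ≤ C) :
    ∃ (ψ : ℕ → ℕ) (v : EuclideanSpace ℝ (Fin n) → ℝ), StrictMono ψ ∧
      AEStronglyMeasurable v volume ∧
      ∀ᵐ x ∂volume, Tendsto (fun k => u (ψ k) x) atTop (𝓝 (v x)) := by
  obtain ⟨ν, hν, hνle, hac⟩ :=
    exists_isFiniteMeasure_le_absolutelyContinuous
      (volume : Measure (EuclideanSpace ℝ (Fin n)))
  have habs : ∀ {t : ℝ}, t ∈ Icc 0 M → |t| ≤ M := fun {t} ht =>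
    abs_le.2 ⟨by linarith [ht.1, ht.2], ht.2⟩
  let means : ℕ → ℕ × (Fin n → ℤ) → Icc 0 M := fun k p =>
    ⟨cubeMean (p.1 + 1) (u k) p.2, cubeMean_mem_Icc p.1.succ_pos (hu k) (hb k) p.2⟩
  obtain ⟨a, χ, hχ, ha⟩ := CompactSpace.tendsto_subseq means
  have hmeans : ∀ N z, Tendsto (fun k => cubeMean (N + 1) (u (χ k)) z) atTop
      (𝓝 (a (N, z) : ℝ)) := fun N z =>
    (continuous_subtype_val.tendsto _).comp (tendsto_pi_nhds.1 ha (N, z))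
  have hconst : Tendsto (fun N => ENNReal.ofReal (cubeConst n α (N + 1)) * C) atTop (𝓝 0) := by
    have h1 := (ENNReal.continuous_ofReal.tendsto 0).comp
      ((tendsto_add_atTop_iff_nat 1).2 (tendsto_cubeConst n hα))
    simpa using ENNReal.Tendsto.mul_const h1 (Or.inr hC)
  obtain ⟨ψ, v, hψ, hvm, hv⟩ := exists_subseq_ae_tendsto_of_approx (ν := ν) (M := M)
    (f := fun k => u (χ k))
    (fun k => MemLp.of_bound (hu _).aestronglyMeasurable M
      (Eventually.of_forall fun x => habs (hb _ x))) (by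
    intro η hη
    obtain ⟨N, hN⟩ := ((tendsto_order.1 hconst).2 (η ^ 2) (by positivity)).exists
    refine ⟨fun k x => cubeMean (N + 1) (u (χ k)) (cubeIndex (N + 1) x),
      fun x => a (N, cubeIndex (N + 1) x),
      fun k => Measurable.comp (g := cubeMean (N + 1) (u (χ k))) (measurable_of_countable _)
        (measurable_cubeIndex _),
      fun k x => habs (cubeMean_mem_Icc N.succ_pos (hu _) (hb _) _), fun x => hmeans _ _,
      fun k => ?_⟩
    rw [← ENNReal.pow_le_pow_left_iff two_ne_zero]
    refine le_trans ?_ hN.le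
    have h2 := eLpNorm_nnreal_pow_eq_lintegral (μ := ν) (p := 2) two_ne_zero
      (f := u (χ k) - fun x => cubeMean (N + 1) (u (χ k)) (cubeIndex (N + 1) x))
    norm_num at h2
    rw [h2]
    refine (lintegral_mono' hνle le_rfl).trans ?_
    refine le_trans (lintegral_mono fun x => ?_)
      ((lintegral_sq_sub_cubeMean_le N.succ_pos hα (hu (χ k)) (hb _)).trans
        (mul_le_mul_right (hE _) _))
    rw [ENNReal.ofReal_pow (abs_nonneg _), Real.enorm_eq_ofReal_abs])
  exact ⟨χ ∘ ψ, v, hχ.comp hψ, hvm.mono_ac hac, hac.ae_le hv⟩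

/-! ### The penalty terms -/

lemma stepReg_eq_clamp {δ : ℝ} (hδ : 0 < δ) (t : ℝ) : stepReg δ t = clamp 1 (t / δ) := by
  unfold stepReg clamp
  split_ifs with h1 h2
  · rw [max_eq_left]
    exact min_le_of_left_le (div_nonpos_of_nonpos_of_nonneg h1 hδ.le)
  · rw [min_eq_left ((div_le_one hδ).2 h2), max_eq_right (div_nonneg (not_le.1 h1).le hδ.le)]
  · rw [min_eq_right ((one_le_div hδ).2 (not_le.1 h2).le), max_eq_right zero_le_one]

lemma continuous_stepReg {δ : ℝ} (hδ : 0 < δ) : Continuous (stepReg δ) := by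
  rw [show stepReg δ = fun t => clamp 1 (t / δ) from funext (stepReg_eq_clamp hδ)]
  exact (continuous_clamp 1).comp (continuous_id.div_const δ)

lemma stepReg_nonneg {δ : ℝ} (hδ : 0 < δ) (t : ℝ) : 0 ≤ stepReg δ t := by
  rw [stepReg_eq_clamp hδ]
  exact clamp_nonneg _ _

lemma stepReg_clamp_le {δ : ℝ} (hδ : 0 < δ) (M t : ℝ) :
    stepReg δ (clamp M t) ≤ stepReg δ t := by
  rcases le_total t 0 with ht | ht
  · have : clamp M t = 0 := max_eq_left (min_le_of_left_le ht)
    rw [this]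
    simpa [stepReg] using stepReg_nonneg hδ t
  · have : clamp M t ≤ t := max_le ht (min_le_left _ _)
    rw [stepReg_eq_clamp hδ, stepReg_eq_clamp hδ]
    unfold clamp at *
    gcongr

lemma le_max_mul_stepReg {δ M t : ℝ} (hδ : 0 < δ) (ht : t ∈ Icc 0 M) :
    t ≤ max δ M * stepReg δ t := by
  unfold stepReg
  split_ifs with h1 h2
  · simpa using h1
  · calc t = δ * (t / δ) := by field_simp
      _ ≤ _ := mul_le_mul_of_nonneg_right (le_max_left _ _) (div_nonneg ht.1 hδ.le)
  · simpa using Or.inr ht.2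

/-- Since `ε ≤ 1 / ε`, the volume penalty is the larger of its two linear pieces. -/
lemma volPenalty_eq_max {γ ε : ℝ} (hε : ε ∈ Ioo (0 : ℝ) 1) (t : ℝ) :
    volPenalty γ ε t = max (1 / ε * (t - γ)) (ε * (t - γ)) := by
  have h : ε ≤ 1 / ε := hε.2.le.trans ((one_le_div hε.1).2 hε.2.le)
  unfold volPenalty
  split_ifs with ht
  · exact (max_eq_left (mul_le_mul_of_nonneg_right h (sub_nonneg.2 ht))).symm
  · exact (max_eq_right
      (mul_le_mul_of_nonpos_right h (sub_nonpos.2 (not_le.1 ht).le))).symm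

lemma continuous_volPenalty {γ ε : ℝ} (hε : ε ∈ Ioo (0 : ℝ) 1) : Continuous (volPenalty γ ε) := by
  rw [funext (volPenalty_eq_max (γ := γ) hε)]
  fun_prop

lemma monotone_volPenalty {γ ε : ℝ} (hε : ε ∈ Ioo (0 : ℝ) 1) : Monotone (volPenalty γ ε) := by
  intro s t hst
  have := hε.1
  rw [volPenalty_eq_max hε, volPenalty_eq_max hε]
  gcongr

lemma volPenaltyExt_ne_bot (γ ε : ℝ) (t : ℝ≥0∞) : volPenaltyExt γ ε t ≠ ⊥ := by
  unfold volPenaltyExt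
  split_ifs <;> simp

lemma monotone_volPenaltyExt {γ ε : ℝ} (hε : ε ∈ Ioo (0 : ℝ) 1) :
    Monotone (volPenaltyExt γ ε) := by
  intro s t hst
  by_cases ht : t = ⊤
  · simp [volPenaltyExt, ht]
  have hs : s ≠ ⊤ := ne_top_of_le_ne_top ht hst
  simp only [volPenaltyExt, if_neg ht, if_neg hs]
  exact EReal.coe_le_coe_iff.2 (monotone_volPenalty hε (ENNReal.toReal_mono ht hst))

lemma continuous_volPenaltyExt {γ ε : ℝ} (hε : ε ∈ Ioo (0 : ℝ) 1) :
    Continuous (volPenaltyExt γ ε) := by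
  refine continuous_iff_continuousAt.2 fun t => ?_
  by_cases ht : t = ⊤
  · subst ht
    rw [ContinuousAt, show volPenaltyExt γ ε ⊤ = ⊤ by simp [volPenaltyExt],
      EReal.tendsto_nhds_top_iff_real]
    intro c
    -- beyond `γ + ε * (|c| + 1)` the penalty exceeds `|c| + 1`
    have hpos : 0 ≤ ε * (|c| + 1) := mul_nonneg hε.1.le (by positivity)
    filter_upwards [eventually_gt_nhds
      (show ENNReal.ofReal (γ + ε * (|c| + 1)) < ⊤ from ENNReal.ofReal_lt_top)] with s hs
    by_cases hst : s = ⊤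
    · simp [volPenaltyExt, hst]
    simp only [volPenaltyExt, if_neg hst]
    rw [EReal.coe_lt_coe_iff, volPenalty_eq_max hε]
    refine lt_max_of_lt_left ?_
    have h1 : γ + ε * (|c| + 1) ≤ s.toReal := (ENNReal.ofReal_le_iff_le_toReal hst).1 hs.le
    rw [one_div, ← div_eq_inv_mul, lt_div_iff₀' hε.1]
    nlinarith [le_abs_self c, hε.1, mul_le_mul_of_nonneg_left (le_abs_self c) hε.1.le]
  · have h1 : ContinuousAt (fun s : ℝ≥0∞ => ((volPenalty γ ε s.toReal : ℝ) : EReal)) t :=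
      continuous_coe_real_ereal.continuousAt.comp
        ((continuous_volPenalty hε).continuousAt.comp (ENNReal.tendsto_toReal ht))
    refine h1.congr ?_
    filter_upwards [isOpen_ne.mem_nhds ht] with s hs
    simp only [volPenaltyExt, if_neg hs]

/-! ### The functional as a combination of its three terms -/

/-- The value of the penalized functional as a function of the energy `e`, the obstacle term `o`
and the volume term `w`. -/
noncomputable def combine (γ ε : ℝ) (p : ℝ≥0∞ × ℝ≥0∞ × ℝ≥0∞) : EReal :=
  (p.1 : EReal) + (p.2.1 : EReal) + volPenaltyExt γ ε p.2.2

lemma coe_add_coe_ne_bot (e o : ℝ≥0∞) : (e : EReal) + (o : EReal) ≠ ⊥ := by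
  rw [← EReal.coe_ennreal_add]
  exact EReal.coe_ennreal_ne_bot _

lemma combine_mono {γ ε : ℝ} (hε : ε ∈ Ioo (0 : ℝ) 1) : Monotone (combine γ ε) := by
  intro p q h
  exact add_le_add (add_le_add (EReal.coe_ennreal_le_coe_ennreal_iff.2 h.1)
    (EReal.coe_ennreal_le_coe_ennreal_iff.2 h.2.1)) (monotone_volPenaltyExt hε h.2.2)

lemma combine_lt {γ ε : ℝ} (hε : ε ∈ Ioo (0 : ℝ) 1) {p q : ℝ≥0∞ × ℝ≥0∞ × ℝ≥0∞}
    (h1 : p.1 < q.1) (h2 : p.2 ≤ q.2) (hq : combine γ ε q ≠ ⊤) :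
    combine γ ε p < combine γ ε q := by
  have hw : volPenaltyExt γ ε q.2.2 ≠ ⊤ := fun h => hq (by
    rw [combine, h, EReal.add_top_of_ne_bot (coe_add_coe_ne_bot _ _)])
  have hs : (q.1 : EReal) + q.2.1 ≠ ⊤ := fun h => hq (by
    rw [combine, h, EReal.top_add_of_ne_bot (volPenaltyExt_ne_bot _ _ _)])
  rw [← EReal.coe_ennreal_add, ne_eq, EReal.coe_ennreal_eq_top_iff, ENNReal.add_eq_top,
    not_or] at hs
  refine EReal.add_lt_add_of_lt_of_le ?_ (monotone_volPenaltyExt hε h2.2)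
    (volPenaltyExt_ne_bot _ _ _) hw
  rw [← EReal.coe_ennreal_add, ← EReal.coe_ennreal_add, EReal.coe_ennreal_lt_coe_ennreal_iff]
  exact ENNReal.add_lt_add_of_lt_of_le (ne_top_of_le_ne_top hs.2 h2.1) h1 h2.1

lemma continuous_combine {γ ε : ℝ} (hε : ε ∈ Ioo (0 : ℝ) 1) : Continuous (combine γ ε) := by
  refine continuous_iff_continuousAt.2 fun p => ?_
  have h1 : ContinuousAt (fun p : ℝ≥0∞ × ℝ≥0∞ × ℝ≥0∞ => (p.1 : EReal) + (p.2.1 : EReal)) p := by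
    simp_rw [← EReal.coe_ennreal_add]
    exact (continuous_coe_ennreal_ereal.comp (by fun_prop)).continuousAt
  have h2 : ContinuousAt (fun p : ℝ≥0∞ × ℝ≥0∞ × ℝ≥0∞ => volPenaltyExt γ ε p.2.2) p :=
    ((continuous_volPenaltyExt hε).comp (by fun_prop)).continuousAt
  exact ContinuousAt.comp₂ (f := fun q : EReal × EReal => q.1 + q.2)
    (EReal.continuousAt_add (Or.inr (volPenaltyExt_ne_bot _ _ _))
      (Or.inl (coe_add_coe_ne_bot _ _))) h1 h2

lemma ne_top_of_combine_ne_top {γ ε : ℝ} {p : ℝ≥0∞ × ℝ≥0∞ × ℝ≥0∞} (hp : combine γ ε p ≠ ⊤) :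
    p.1 ≠ ⊤ ∧ p.2.2 ≠ ⊤ := by
  constructor
  · intro h
    refine hp ?_
    rw [combine, ← EReal.coe_ennreal_add, h, top_add, EReal.coe_ennreal_top,
      EReal.top_add_of_ne_bot (volPenaltyExt_ne_bot _ _ _)]
  · intro h
    refine hp ?_
    rw [combine, h, show volPenaltyExt γ ε ⊤ = ⊤ by simp [volPenaltyExt],
      EReal.add_top_of_ne_bot (coe_add_coe_ne_bot _ _)]

/-- The energy, the obstacle term and the volume term of the penalized functional. -/
noncomputable def terms {n : ℕ} (α δ : ℝ) (g : ℝ → ℝ) (Ω : Set (EuclideanSpace ℝ (Fin n)))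
    (φ u : EuclideanSpace ℝ (Fin n) → ℝ) : ℝ≥0∞ × ℝ≥0∞ × ℝ≥0∞ :=
  (energy α u, ∫⁻ x, ENNReal.ofReal (g (u x - φ x)),
    ∫⁻ x in Ωᶜ, ENNReal.ofReal (stepReg δ (u x)))

variable {α γ δ ε σ M : ℝ} {g : ℝ → ℝ} {Ω : Set (EuclideanSpace ℝ (Fin n))}
  {φ u : EuclideanSpace ℝ (Fin n) → ℝ}

lemma penalized_eq_combine :
    penalized α γ δ ε g Ω φ u = combine γ ε (terms α δ g Ω φ u) := rfl

lemma terms_congr {v : EuclideanSpace ℝ (Fin n) → ℝ} (h : u =ᵐ[volume] v) :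
    terms α δ g Ω φ u = terms α δ g Ω φ v := by
  refine Prod.ext (energy_congr h) (Prod.ext (lintegral_congr_ae ?_) (lintegral_congr_ae ?_))
  · exact h.mono fun x hx => by simp only [hx]
  · exact (ae_restrict_of_ae h).mono fun x hx => by simp only [hx]

/-- Truncation to `[0, M]`, with `M` an upper bound of the obstacle, increases none of the terms. -/
lemma terms_clamp_le (hδ : 0 < δ) (hg : IsObstaclePenalty σ g) (hφM : ∀ x, φ x ≤ M) :
    terms α δ g Ω φ (fun x => clamp M (u x)) ≤ terms α δ g Ω φ u := by
  refine ⟨energy_clamp_le α M u, lintegral_mono fun x => ENNReal.ofReal_le_ofReal ?_,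
    lintegral_mono fun x => ENNReal.ofReal_le_ofReal (stepReg_clamp_le hδ _ _)⟩
  rcases le_total (u x) M with h | h
  · refine hg.antitone (sub_le_sub_right ?_ _)
    exact (min_eq_left h).ge.trans (le_max_right _ _)
  · have hM : M ≤ clamp M (u x) := by
      rw [clamp, min_eq_right h]
      exact le_max_right _ _
    rw [hg.eq_zero_of_nonneg _ (sub_nonneg.2 ((hφM x).trans hM))]
    exact hg.nonneg _

/-- Lower semicontinuity of the three terms under almost everywhere convergence (Fatou's lemma). -/
lemma terms_le_of_tendsto (hδ : 0 < δ) (hg : Continuous g) (hφ : Continuous φ)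
    {v : ℕ → EuclideanSpace ℝ (Fin n) → ℝ} (hv : ∀ k, Measurable (v k))
    (h : ∀ᵐ x ∂volume, Tendsto (fun k => v k x) atTop (𝓝 (u x))) {p : ℝ≥0∞ × ℝ≥0∞ × ℝ≥0∞}
    (hp : Tendsto (fun k => terms α δ g Ω φ (v k)) atTop (𝓝 p)) :
    terms α δ g Ω φ u ≤ p := by
  have hp1 := (continuous_fst.tendsto p).comp hp
  have hp2 := (continuous_fst.tendsto p.2).comp ((continuous_snd.tendsto p).comp hp)
  have hp3 := (continuous_snd.tendsto p.2).comp ((continuous_snd.tendsto p).comp hp)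
  have hstep := continuous_stepReg hδ
  refine ⟨?_, ?_, ?_⟩
  · rw [← hp1.liminf_eq]
    exact energy_le_liminf (fun k => (hv k).aemeasurable) h
  · rw [← hp2.liminf_eq]
    refine le_trans ?_ (lintegral_liminf_le fun k => ENNReal.measurable_ofReal.comp
      (hg.measurable.comp ((hv k).sub hφ.measurable)))
    refine lintegral_mono_ae (h.mono fun x hx => (Tendsto.liminf_eq ?_).ge)
    exact (ENNReal.continuous_ofReal.tendsto _).comp
      ((hg.tendsto _).comp (hx.sub tendsto_const_nhds))
  · rw [← hp3.liminf_eq]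
    refine le_trans ?_ (lintegral_liminf_le fun k => ENNReal.measurable_ofReal.comp
      (hstep.measurable.comp (hv k)))
    refine lintegral_mono_ae ((ae_restrict_of_ae h).mono fun x hx => (Tendsto.liminf_eq ?_).ge)
    exact (ENNReal.continuous_ofReal.tendsto _).comp ((hstep.tendsto _).comp hx)

/-- A bounded nonnegative function is square integrable on the finite measure set `Ω`, and on its
complement its square is dominated by its regularized step. -/
lemma memLp_two_of_lintegral_stepReg_ne_top (hδ : 0 < δ) 
    (hΩf : volume Ω ≠ ⊤) (hu : AEStronglyMeasurable u volume)
    (hb : ∀ᵐ x ∂volume, u x ∈ Icc 0 M)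
    (h : ∫⁻ x in Ωᶜ, ENNReal.ofReal (stepReg δ (u x)) ≠ ⊤) : MemLp u 2 volume := by
  rw [memLp_two_iff_integrable_sq hu, ← integrableOn_univ, ← union_compl_self Ω]
  refine IntegrableOn.union ?_ ?_
  · refine Measure.integrableOn_of_bounded (M := M ^ 2) hΩf (hu.pow 2) ?_
    refine (ae_restrict_of_ae hb).mono fun x hx => ?_
    rw [Real.norm_eq_abs, abs_of_nonneg (sq_nonneg _)]
    exact pow_le_pow_left₀ hx.1 hx.2 2
  · have hint : IntegrableOn (fun x => stepReg δ (u x)) Ωᶜ volume :=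
      ⟨((continuous_stepReg hδ).comp_aestronglyMeasurable hu).restrict,
        (hasFiniteIntegral_iff_ofReal
          (Eventually.of_forall fun x => stepReg_nonneg hδ _)).2 h.lt_top⟩
    refine Integrable.mono' (hint.const_mul (max δ M * max δ M)) (hu.pow 2).restrict ?_
    refine (ae_restrict_of_ae hb).mono fun x hx => ?_
    rw [Real.norm_eq_abs, abs_of_nonneg (sq_nonneg _), pow_two, mul_assoc]
    exact mul_le_mul (hx.2.trans (le_max_right _ _)) (le_max_mul_stepReg hδ hx) hx.1
      (hδ.le.trans (le_max_left _ _))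

lemma zero_mem_fracSobolev : (fun _ => 0) ∈ fracSobolev n α :=
  ⟨MemLp.zero, by simp [energy]⟩

lemma penalized_zero_ne_top (hg : IsObstaclePenalty σ g) (hφ : Continuous φ)
    (hφc : HasCompactSupport φ) : penalized α γ δ ε g Ω φ (fun _ => 0) ≠ ⊤ := by
  have hint : Integrable (fun x => g (0 - φ x)) volume := by
    refine Continuous.integrable_of_hasCompactSupport
      (hg.smooth.continuous.comp (continuous_const.sub hφ)) ?_
    exact hφc.comp_left (g := fun t => g (0 - t)) (by simpa using hg.eq_zero_of_nonneg 0 le_rfl)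
  have h1 : ∫⁻ x, ENNReal.ofReal (g (0 - φ x)) ≠ ⊤ := hint.lintegral_lt_top.ne
  rw [penalized, ← EReal.coe_ennreal_add]
  refine EReal.add_ne_top ?_ ?_
  · rw [ne_eq, EReal.coe_ennreal_eq_top_iff, ENNReal.add_eq_top, not_or]
    exact ⟨zero_mem_fracSobolev.2.ne, h1⟩
  · simp [stepReg, volPenaltyExt]

/-! ### Existence and bounds -/

/-- Direct method: a minimizing sequence, truncated to `[0, M]`, has a subsequence that converges
almost everywhere and along which the three terms converge; the limit minimizes. -/
lemma exists_isMinimizer (hα : 0 < α) (hδ : 0 < δ) (hε : ε ∈ Ioo (0 : ℝ) 1)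
    (hg : IsObstaclePenalty σ g) (hΩf : volume Ω ≠ ⊤) (hφ : Continuous φ)
    (hφc : HasCompactSupport φ) (hM : 0 ≤ M) (hφM : ∀ x, φ x ≤ M) :
    ∃ u, IsMinimizer α γ δ ε g Ω φ u := by
  set S := penalized α γ δ ε g Ω φ '' fracSobolev n α
  obtain ⟨s, -, hs, hsS⟩ := exists_seq_tendsto_sInf (S := S)
    ⟨_, mem_image_of_mem _ zero_mem_fracSobolev⟩ (OrderBot.bddBelow S)
  choose w hw hws using hsS
  have hm : sInf S ≠ ⊤ := ne_top_of_le_ne_top (penalized_zero_ne_top hg hφ hφc)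
    (sInf_le (mem_image_of_mem _ zero_mem_fracSobolev))
  let v : ℕ → EuclideanSpace ℝ (Fin n) → ℝ := fun k x => clamp M ((hw k).1.1.mk (w k) x)
  have hvm : ∀ k, Measurable (v k) := fun k =>
    (continuous_clamp M).measurable.comp (hw k).1.1.stronglyMeasurable_mk.measurable
  have hvb : ∀ k x, v k x ∈ Icc 0 M := fun k x => ⟨clamp_nonneg _ _, clamp_le hM _⟩
  have hvae : ∀ k, v k =ᵐ[volume] fun x => clamp M (w k x) := fun k =>
    (hw k).1.1.ae_eq_mk.mono fun x hx => by simp only [v, hx]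
  have hvle : ∀ k, combine γ ε (terms α δ g Ω φ (v k)) ≤ s k := fun k => by
    rw [← hws k, penalized_eq_combine, terms_congr (hvae k)]
    exact combine_mono hε (terms_clamp_le hδ hg hφM)
  have hvge : ∀ k, sInf S ≤ combine γ ε (terms α δ g Ω φ (v k)) := fun k => by
    rw [terms_congr (hvae k), ← penalized_eq_combine]
    exact sInf_le (mem_image_of_mem _ (clamp_mem_fracSobolev hM (hw k)))
  have hvlim : Tendsto (fun k => combine γ ε (terms α δ g Ω φ (v k))) atTop (𝓝 (sInf S)) :=
    tendsto_of_tendsto_of_tendsto_of_le_of_le tendsto_const_nhds hs hvge hvle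
  obtain ⟨p, χ, hχ, hp⟩ := CompactSpace.tendsto_subseq fun k => terms α δ g Ω φ (v k)
  have hpS : combine γ ε p = sInf S :=
    tendsto_nhds_unique (((continuous_combine hε).tendsto p).comp hp)
      (hvlim.comp hχ.tendsto_atTop)
  obtain ⟨hp1, hp3⟩ := ne_top_of_combine_ne_top (hpS.trans_ne hm)
  have hEv : ∀ᶠ k in atTop, energy α (v (χ k)) < p.1 + 1 :=
    (tendsto_order.1 ((continuous_fst.tendsto p).comp hp)).2 _
      (ENNReal.lt_add_right hp1 one_ne_zero)
  obtain ⟨K, hK⟩ := eventually_atTop.1 hEv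
  obtain ⟨ψ, u, hψ, hum, hu⟩ := exists_subseq_ae_tendsto_of_energy_le hα (M := M)
    (ENNReal.add_ne_top.2 ⟨hp1, ENNReal.one_ne_top⟩) (u := fun k => v (χ (k + K)))
    (fun k => hvm _) (fun k => hvb _) (fun k => (hK _ (Nat.le_add_left _ _)).le)
  have hle : terms α δ g Ω φ u ≤ p :=
    terms_le_of_tendsto hδ hg.smooth.continuous hφ (fun k => hvm (χ (ψ k + K))) hu
      (hp.comp ((tendsto_add_atTop_nat K).comp hψ.tendsto_atTop))
  have hub : ∀ᵐ x ∂volume, u x ∈ Icc 0 M :=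
    hu.mono fun x hx => isClosed_Icc.mem_of_tendsto hx (Eventually.of_forall fun k => hvb _ x)
  refine ⟨u, ⟨memLp_two_of_lintegral_stepReg_ne_top hδ hΩf hum hub
    (ne_top_of_le_ne_top hp3 hle.2.2), hle.1.trans_lt hp1.lt_top⟩, fun z hz => ?_⟩
  rw [penalized_eq_combine]
  exact (combine_mono hε hle).trans (hpS.le.trans (sInf_le (mem_image_of_mem _ hz)))

/-- Truncating a minimizer cannot lower its energy. -/
lemma IsMinimizer.energy_le_energy_clamp (hu : IsMinimizer α γ δ ε g Ω φ u) (hδ : 0 < δ)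
    (hε : ε ∈ Ioo (0 : ℝ) 1) (hg : IsObstaclePenalty σ g) (hM : 0 ≤ M) (hφM : ∀ x, φ x ≤ M)
    (hfin : penalized α γ δ ε g Ω φ u ≠ ⊤) :
    energy α u ≤ energy α (fun x => clamp M (u x)) := by
  by_contra! hlt
  exact (combine_lt (γ := γ) hε (p := terms α δ g Ω φ fun x => clamp M (u x))
    (q := terms α δ g Ω φ u) hlt (terms_clamp_le hδ hg hφM).2 hfin).not_ge
    (hu.2 _ (clamp_mem_fracSobolev hM hu.1))

end FracPenalization

theorem proposition2p1 (n : ℕ) (hn : 1 ≤ n)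
    (α : ℝ) (hα : α ∈ Set.Ioo (0 : ℝ) 1) (γ : ℝ) (hγ : 0 < γ)
    (Ω : Set (EuclideanSpace ℝ (Fin n))) (hΩo : IsOpen Ω) (hΩb : Bornology.IsBounded Ω)
    (φ : EuclideanSpace ℝ (Fin n) → ℝ) (hφ : ContDiff ℝ ∞ φ) (hφ0 : ∀ x, 0 ≤ φ x)
    (hφc : HasCompactSupport φ) (hφΩ : tsupport φ ⊆ Ω)
    (σ δ ε : ℝ) (hσ : σ ∈ Set.Ioo (0 : ℝ) 1) (hδ : δ ∈ Set.Ioo (0 : ℝ) 1)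
    (hε : ε ∈ Set.Ioo (0 : ℝ) 1)
    (g : ℝ → ℝ) (hg : FracPenalization.IsObstaclePenalty σ g) :
    (∃ u, FracPenalization.IsMinimizer α γ δ ε g Ω φ u ∧
      FracPenalization.penalized α γ δ ε g Ω φ u ≠ ⊤) ∧
    (∀ u, FracPenalization.IsMinimizer α γ δ ε g Ω φ u →
      ∀ᵐ x ∂volume, 0 ≤ u x ∧ u x ≤ ⨆ y, |φ y|) := by
  have hbdd : BddAbove (range fun y => |φ y|) :=
    hφ.continuous.abs.bddAbove_range_of_hasCompactSupport (hφc.comp_left (g := abs) abs_zero)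
  have hφM : ∀ x, φ x ≤ ⨆ y, |φ y| := fun x => (le_abs_self _).trans (le_ciSup hbdd x)
  have hM : 0 ≤ ⨆ y, |φ y| := (hφ0 0).trans (hφM 0)
  have hfin : ∀ u, FracPenalization.IsMinimizer α γ δ ε g Ω φ u →
      FracPenalization.penalized α γ δ ε g Ω φ u ≠ ⊤ := fun u hu =>
    ne_top_of_le_ne_top (FracPenalization.penalized_zero_ne_top hg hφ.continuous hφc)
      (hu.2 _ FracPenalization.zero_mem_fracSobolev)
  constructor
  · obtain ⟨u, hu⟩ := FracPenalization.exists_isMinimizer (γ := γ) hα.1 hδ.1 hε hg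
      hΩb.measure_lt_top.ne hφ.continuous hφc hM hφM
    exact ⟨u, hu, hfin u hu⟩
  · intro u hu
    exact FracPenalization.ae_mem_Icc_of_energy_le_energy_clamp hn hM hu.1
      (hu.energy_le_energy_clamp hδ.1 hε hg hM hφM (hfin u hu))
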